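/- Fix real numbers $s_+ > s_- \ge 0$ and let $\sigma$ be the ReLU-like activation $\sigma(t) = s_+ t$ for $t \ge 0$, $\sigma(t) = s_- t$ for $t < 0$. Let $L$ be a positive integer and let $d_0 = d_x, d_1, \dots, d_{L-1}, d_L = d_y$ be positive integers. An $L$-layer fully connected network (FNN) with hidden widths $d_1,\dots,d_{L-1}$ and parameters $\theta = (W^l, b^l)_{l=1}^L$, $W^l \in \mathbb{R}^{d_l \times d_{l-1}}$, $b^l \in \mathbb{R}^{d_l}$, computes $$a^0(x) = x,\qquad a^l(x) = \sigma\bigl(W^l a^{l-1}(x) + b^l\bigr)\ \ (1 \le l \le L-1),\qquad f_\theta(x) = W^L a^{L-1}(x) + b^L,$$ with $\sigma$ applied entrywise. Let $\{(x_i,y_i)\}_{i=1}^N$ be a dataset with pairwise distinct $x_i \in \mathbb{R}^{d_x}$ and with $y_i \in [-1,1]^{d_y}$. Suppose that there are $m \ge 1$ and indices $l_1,\dots,l_m \in \{1,\dots,L-2\}$ such that, with $r_j = d_y \mathbf{1}\{j>1\} + \mathbf{1}\{j<m\}$ for $1 \le j \le m$, - $l_j + 1 < l_{j+1}$ for $1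 \le j \le m-1$; - $d_{l_j} \ge r_j$ and $d_{l_j+1} \ge r_j$ for $1 \le j \le m$, and $$4 \sum_{j=1}^m \left\lfloor \frac{d_{l_j}-r_j}{4} \right\rfloor \left\lfloor \frac{d_{l_j+1}-r_j}{4 d_y} \right\rfloor \ge N;$$ - $d_k \ge d_y + 1$ for all $k$ with $l_j + 2 \le k \le l_{j+1} - 1$ for some $1 \le j \le m-1$; - $d_k \ge d_y$ for all $k$ with $l_m + 2 \le k \le L-1$. Then there exists $\theta$ such that $f_\theta(x_i) = y_i$ for all $i \in \{1,\dots,N\}$. -/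

import Mathlib

/-- The ReLU-like activation with slope `sPos` on `[0, ∞)` and slope `sNeg` on `(-∞, 0)`. -/
noncomputable def reluLike (sPos sNeg : ℝ) (t : ℝ) : ℝ :=
  if 0 ≤ t then sPos * t else sNeg * t

/-- The parameters of an `L`-layer fully connected network whose `l`-th layer has width `d l`
(`d 0` is the input dimension, `d L` the output dimension). The field `W` at index `l` is the
matrix from layer `l` to layer `l + 1`, of size `d (l + 1) × d l`. -/
structure FNNParams (L : ℕ) (d : ℕ → ℕ) where
  /-- weight matrices -/
  W : ∀ l : Fin L, Matrix (Fin (d (l + 1))) (Fin (d l)) ℝ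
  /-- bias vectors -/
  b : ∀ l : Fin L, Fin (d (l + 1)) → ℝ

namespace FNNParams

/-- The output of layer `l` on the input `x`: layer `0` is the input itself, the layers
`1, …, L - 1` apply the affine map and then `σ` entrywise, and layer `L` only the affine map. -/
noncomputable def layerOut {L : ℕ} {d : ℕ → ℕ} (σ : ℝ → ℝ) (θ : FNNParams L d)
    (x : Fin (d 0) → ℝ) : (l : ℕ) → l ≤ L → (Fin (d l) → ℝ)
  | 0, _ => x
  | l + 1, h =>
    let z : Fin (d (l + 1)) → ℝ :=
      (θ.W ⟨l, h⟩).mulVec (layerOut σ θ x l (Nat.le_of_succ_le h)) + θ.b ⟨l, h⟩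
    if l + 1 < L then fun i => σ (z i) else z

/-- The function computed by the `L`-layer network with activation `σ` and parameters `θ`. -/
noncomputable def eval {L : ℕ} {d : ℕ → ℕ} (σ : ℝ → ℝ) (θ : FNNParams L d)
    (x : Fin (d 0) → ℝ) : Fin (d L) → ℝ :=
  layerOut σ θ x L le_rfl

end FNNParams

/-- `r_j = d_y · 𝟙{j > 1} + 𝟙{j < m}`. -/
def reservedWidth (dy m j : ℕ) : ℕ :=
  dy * (if 1 < j then 1 else 0) + (if j < m then 1 else 0)

/-!
A generic linear functional, shifted by a constant, turns the inputs into distinct nonnegative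
numbers `c i`. A layer with `p` nodes `σ (c - τ s)` yields, up to affine maps, all continuous
piecewise linear functions of `c` with `p` pieces separated by the breakpoints `τ s`
(`hingeSum_mem_affineFeatures`). Such a function can zigzag through one prescribed point on each
piece, and so steeply that its absolute value is at least `1` at all other data points
(`exists_hingeSum_interpolating`). Its composition with a tent function supported on `[-1, 1]`
then fits one data point per piece and vanishes at the other data points. A tent is a second
difference of the activation (`reluLike_second_difference`) and costs three nodes of the next
layer, so `Q` of them per output coordinate fit `p * Q` data points on the same breakpoints
(`exists_sum_tent_hingeSum`).

The network uses the pairs of layers `l j`, `l j + 1` in this way (`FNNParams.Computes.fit`), each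
for its own share of the data points. The activation is linear on nonnegative numbers, so one
reserved node per layer is enough to carry a nonnegative function to the layers above
(`FNNParams.Computes.carry`). The functions carried are `c` and, for every output coordinate, the
sum of the values fitted so far; labels are moved from `[-1, 1]` to `[0, 1]` to make these sums
nonnegative. The relation `FNNParams.Computes` hides the weights: it says which functions on the
dataset are affine in the output of a layer, and `FNNParams.Computes.activate` describes what a
hidden layer adds.
-/

/-! ### The tent function -/

/-- The tent function, supported on `[-1, 1]`, with apex `1` at `0`. -/
noncomputable def tent (t : ℝ) : ℝ := max 0 (1 - |t|)

theorem tent_one_sub {w : ℝ} (h : w ∈ Set.Icc (0 : ℝ) 1) : tent (1 - w) = w := by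
  rw [tent, abs_of_nonneg (by linarith [h.2])]
  simpa using h.1

theorem tent_eq_zero {t : ℝ} (h : 1 ≤ |t|) : tent t = 0 :=
  max_eq_left (by linarith)

theorem reluLike_of_nonneg (sPos sNeg : ℝ) {t : ℝ} (h : 0 ≤ t) :
    reluLike sPos sNeg t = sPos * t := if_pos h

theorem reluLike_eq (sPos sNeg t : ℝ) :
    reluLike sPos sNeg t = sNeg * t + (sPos - sNeg) * max t 0 := by
  unfold reluLike
  split_ifs with h
  · rw [max_eq_left h]; ring
  · rw [max_eq_right (by linarith)]; ring

/-- The second difference removes the linear part of the activation, so that three nodes compute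
a tent function exactly, whatever the slopes are. -/
theorem reluLike_second_difference (sPos sNeg t : ℝ) :
    reluLike sPos sNeg (t + 1) - 2 * reluLike sPos sNeg t + reluLike sPos sNeg (t - 1)
      = (sPos - sNeg) * tent t := by
  have key : max (t + 1) 0 - 2 * max t 0 + max (t - 1) 0 = tent t := by
    unfold tent
    rcases le_total 0 t with h | h
    · rw [abs_of_nonneg h, max_eq_left (by linarith : 0 ≤ t + 1), max_eq_left h]
      rcases le_total 1 t with h1 | h1
      · rw [max_eq_left (by linarith), max_eq_left (by linarith)]; ring
      · rw [max_eq_right (by linarith), max_eq_right (by linarith)]; ring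
    · rw [abs_of_nonpos h, max_eq_right h, max_eq_right (by linarith : t - 1 ≤ 0)]
      rcases le_total (-1) t with h1 | h1
      · rw [max_eq_left (by linarith), max_eq_right (by linarith)]; ring
      · rw [max_eq_right (by linarith), max_eq_left (by linarith)]; ring
  rw [reluLike_eq, reluLike_eq, reluLike_eq, ← key]
  ring

/-! ### Steep zigzag functions with prescribed breakpoints -/

/-- The continuous piecewise linear function with breakpoints `τ 1, …, τ n`, leftmost slope `a`,
and slope change `α s` at `τ s`. -/
noncomputable def hingeSum (n : ℕ) (τ : ℕ → ℝ) (a b : ℝ) (α : ℕ → ℝ) (t : ℝ) : ℝ :=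
  a * t + b + ∑ s ∈ Finset.Icc 1 n, α s * max (t - τ s) 0

/-- With breakpoints separating the nodes `z s`, a continuous piecewise linear function can take
prescribed values at the nodes and be as steep as desired on every piece. The steepness of the
piece to the left of a new breakpoint forces that of the piece to its right, so the induction
asks the previous function for a larger steepness. -/
theorem exists_steep_hingeSum (n : ℕ) (τ z u : ℕ → ℝ) (hz : ∀ s, z s < τ (s + 1))
    (hτ : ∀ s, τ (s + 1) < z (s + 1)) (M : ℝ) :
    ∃ a b α, ∀ s ≤ n, ∃ k : ℝ, M ≤ |k| ∧ ∀ t, (0 < s → τ s ≤ t) → (s < n → t ≤ τ (s + 1)) →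
      hingeSum n τ a b α t = u s + k * (t - z s) := by
  induction n generalizing M with
  | zero =>
    refine ⟨M, u 0 - M * z 0, 0, fun s hs => ⟨M, le_abs_self M, fun t _ _ => ?_⟩⟩
    obtain rfl : s = 0 := by omega
    simp [hingeSum]; ring
  | succ n ih =>
    have h1 := hz n
    have h2 := hτ n
    set T := τ (n + 1) with hT
    obtain ⟨a, b, α, h⟩ := ih
      (max M ((M * (z (n + 1) - T) + |u (n + 1) - u n|) / (T - z n)))
    obtain ⟨k, hk, hkt⟩ := h n le_rfl
    -- the slope after the breakpoint `T` that leads to the value `u (n + 1)` at `z (n + 1)`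
    set k' := (u (n + 1) - u n - k * (T - z n)) / (z (n + 1) - T) with hk'
    have hk'mul : k' * (z (n + 1) - T) = u (n + 1) - u n - k * (T - z n) :=
      div_mul_cancel₀ _ (by linarith)
    have hsteep : M ≤ |k'| := by
      have h3 := (le_max_right _ _).trans hk
      rw [div_le_iff₀ (by linarith)] at h3
      have h4 : |k'| * (z (n + 1) - T) = |k * (T - z n) - (u (n + 1) - u n)| := by
        rw [abs_sub_comm, ← hk'mul, abs_mul, abs_of_pos (show 0 < z (n + 1) - T by linarith)]
      have h5 := abs_sub_abs_le_abs_sub (k * (T - z n)) (u (n + 1) - u n)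
      rw [abs_mul, abs_of_pos (show 0 < T - z n by linarith)] at h5
      exact le_of_mul_le_mul_right (by linarith) (show 0 < z (n + 1) - T by linarith)
    have hsucc : ∀ t, hingeSum (n + 1) τ a b (Function.update α (n + 1) (k' - k)) t
        = hingeSum n τ a b α t + (k' - k) * max (t - T) 0 := by
      intro t
      unfold hingeSum
      rw [Finset.sum_Icc_succ_top (by omega), Function.update_self, ← add_assoc]
      congr 2
      refine Finset.sum_congr rfl fun s hs => ?_
      rw [Function.update_of_ne (by simp at hs; omega)]
    refine ⟨a, b, Function.update α (n + 1) (k' - k), fun s hs => ?_⟩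
    rcases Nat.lt_or_ge n s with hsn | hsn
    · obtain rfl : s = n + 1 := by omega
      refine ⟨k', hsteep, fun t ht _ => ?_⟩
      have ht : T ≤ t := ht (by omega)
      have hn : 0 < n → τ n ≤ t := by
        intro h0
        obtain ⟨n', rfl⟩ : ∃ n', n = n' + 1 := ⟨n - 1, by omega⟩
        linarith [hτ n']
      rw [hsucc, hkt t hn (by omega), max_eq_left (by linarith)]
      linear_combination hk'mul
    · obtain ⟨k₀, hk₀, hk₀t⟩ := h s hsn
      refine ⟨k₀, (le_max_left _ _).trans hk₀, fun t ht ht' => ?_⟩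
      have ht' := ht' (by omega)
      have htT : t ≤ T := by
        refine ht'.trans ?_
        have hmono : StrictMono fun s => τ (s + 1) :=
          strictMono_nat_of_lt_succ fun s => (hτ s).trans (hz (s + 1))
        exact hmono.monotone hsn
      rw [hsucc, max_eq_right (by linarith), mul_zero, add_zero]
      exact hk₀t t ht fun _ => ht'

/-- A zigzag function through the prescribed points `(z s, u s)` that leaves the interval `(-1, 1)`
at all other points of the finite set `X`. -/
theorem exists_hingeSum_interpolating (n : ℕ) (τ z u : ℕ → ℝ) (hz : ∀ s, z s < τ (s + 1))
    (hτ : ∀ s, τ (s + 1) < z (s + 1)) (X : Finset ℝ) :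
    ∃ a b α, (∀ s ≤ n, hingeSum n τ a b α (z s) = u s) ∧
      ∀ t ∈ X, (∀ s ≤ n, t ≠ z s) → 1 ≤ |hingeSum n τ a b α t| := by
  obtain ⟨M, hM⟩ : ∃ M : ℝ, ∀ p ∈ X ×ˢ Finset.range (n + 1),
      (1 + |u p.2|) / |p.1 - z p.2| ≤ M := by
    obtain ⟨M, hM⟩ := ((X ×ˢ Finset.range (n + 1)).image
      fun p => (1 + |u p.2|) / |p.1 - z p.2|).exists_le
    exact ⟨M, fun p hp => hM _ (Finset.mem_image_of_mem _ hp)⟩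
  obtain ⟨a, b, α, h⟩ := exists_steep_hingeSum n τ z u hz hτ M
  refine ⟨a, b, α, fun s hs => ?_, fun t ht hne => ?_⟩
  · obtain ⟨k, -, hk⟩ := h s hs
    rw [hk (z s) _ fun _ => (hz s).le]
    · ring
    · intro h0
      obtain ⟨s', rfl⟩ : ∃ s', s = s' + 1 := ⟨s - 1, by omega⟩
      exact (hτ s').le
  · -- the last piece starting to the left of `t` contains `t`
    obtain ⟨s, hs, hst, hst'⟩ : ∃ s ≤ n, (0 < s → τ s ≤ t) ∧ (s < n → t ≤ τ (s + 1)) := by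
      classical
      have hP : (0 : ℕ) < 0 → τ 0 ≤ t := by simp
      refine ⟨Nat.findGreatest (fun s => 0 < s → τ s ≤ t) n, Nat.findGreatest_le n,
        Nat.findGreatest_spec (P := fun s => 0 < s → τ s ≤ t) (Nat.zero_le n) hP, fun hlt => ?_⟩
      have := Nat.findGreatest_is_greatest (P := fun s => 0 < s → τ s ≤ t)
        (Nat.lt_succ_self _) hlt
      push Not at this
      exact this.2.le
    obtain ⟨k, hkM, hk⟩ := h s hs
    have hpos : 0 < |t - z s| := abs_pos.2 (sub_ne_zero.2 (hne s hs))
    have h1 := (hM (t, s) (by simp [ht]; omega)).trans hkM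
    rw [div_le_iff₀ hpos, ← abs_mul] at h1
    rw [hk t hst hst']
    have h2 := abs_sub_abs_le_abs_sub (k * (t - z s)) (-u s)
    rw [abs_neg, sub_neg_eq_add, add_comm _ (u s)] at h2
    linarith

/-! ### Sums of tents over zigzag functions with common breakpoints -/

/-- A finite set of reals is enumerated in increasing order by an initial segment of a strictly
increasing sequence. The remaining terms serve as padding. -/
theorem exists_strictMono_enumeration (S : Finset ℝ) :
    ∃ E : ℕ → ℝ, StrictMono E ∧ ∀ t ∈ S, ∃ k < S.card, E k = t := by
  classical
  induction S using Finset.induction_on_max with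
  | empty => exact ⟨fun k => k, Nat.strictMono_cast, by simp⟩
  | insert a S ha ih =>
    obtain ⟨E, hE, hES⟩ := ih
    have haS : a ∉ S := fun h => lt_irrefl _ (ha a h)
    -- the first `S.card` terms can only be elements of `S`
    have hsurj : ∀ k < S.card, E k ∈ S := by
      have hsub : S ⊆ (Finset.range S.card).image E := fun t ht => by
        obtain ⟨k, hk, rfl⟩ := hES t ht
        exact Finset.mem_image_of_mem _ (Finset.mem_range.2 hk)
      have heq := Finset.eq_of_subset_of_card_le hsub (by
        rw [Finset.card_image_of_injective _ hE.injective, Finset.card_range])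
      intro k hk
      rw [heq]
      exact Finset.mem_image_of_mem _ (Finset.mem_range.2 hk)
    refine ⟨fun k => if k < S.card then E k else a + ((k : ℝ) - S.card),
      strictMono_nat_of_lt_succ fun k => ?_, fun t ht => ?_⟩
    · rcases lt_trichotomy (k + 1) S.card with h | h | h
      · simp only [h, (Nat.lt_succ_self k).trans h, if_true]
        exact hE (Nat.lt_succ_self k)
      · have hk : k < S.card := by omega
        simp only [hk, if_true, h, lt_irrefl, if_false]
        have := ha _ (hsurj k hk)
        simpa using this
      · simp only [show ¬ k < S.card by omega, show ¬ k + 1 < S.card by omega, if_false]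
        push_cast; linarith
    · rw [Finset.card_insert_of_notMem haS]
      rcases Finset.mem_insert.1 ht with rfl | ht
      · exact ⟨S.card, Nat.lt_succ_self _, by simp⟩
      · obtain ⟨k, hk, rfl⟩ := hES t ht
        exact ⟨k, hk.trans (Nat.lt_succ_self _), by simp [hk]⟩

/-- `n` breakpoints, depending on `S` only, and `Q` tents suffice to fit values in `[0, 1]` at
`(n + 1) * Q` points of `S` and the value `0` at the other points of `X`. The sorted points are
cut into `n + 1` groups of size `Q`, and the `q`-th tent takes care of the `q`-th point of every
group. -/
theorem exists_sum_tent_hingeSum (X S : Finset ℝ) (n Q : ℕ) (hS : S.card ≤ (n + 1) * Q) :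
    ∃ τ : ℕ → ℝ, ∀ w : ℝ → ℝ, (∀ t, w t ∈ Set.Icc (0 : ℝ) 1) → (∀ t ∉ S, w t = 0) →
      ∃ (a b : ℕ → ℝ) (α : ℕ → ℕ → ℝ), ∀ t ∈ X,
        ∑ q ∈ Finset.range Q, tent (hingeSum n τ (a q) (b q) (α q) t) = w t := by
  obtain ⟨E, hE, hES⟩ := exists_strictMono_enumeration S
  -- breakpoints midway between consecutive groups; `τ 0`, with a truncated index, is never used
  refine ⟨fun s => (E (s * Q - 1) + E (s * Q)) / 2, fun w hw hwS => ?_⟩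
  have key : ∀ q < Q, _ := fun q hq =>
    exists_hingeSum_interpolating n (fun s => (E (s * Q - 1) + E (s * Q)) / 2)
      (fun s => E (s * Q + q)) (fun s => 1 - w (E (s * Q + q)))
      (fun s => by
        have h1 : E (s * Q + q) ≤ E ((s + 1) * Q - 1) :=
          hE.monotone (by rw [Nat.succ_mul]; omega)
        have h2 : E ((s + 1) * Q - 1) < E ((s + 1) * Q) := hE (by rw [Nat.succ_mul]; omega)
        linarith)
      (fun s => by
        have h1 : E ((s + 1) * Q) ≤ E ((s + 1) * Q + q) := hE.monotone (by omega)
        have h2 : E ((s + 1) * Q - 1) < E ((s + 1) * Q) := hE (by rw [Nat.succ_mul]; omega)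
        linarith) X
  choose! a b α hz hX using key
  refine ⟨a, b, α, fun t ht => ?_⟩
  by_cases hmem : ∃ k < (n + 1) * Q, E k = t
  · obtain ⟨k, hk, rfl⟩ := hmem
    have hQ : 0 < Q := Nat.pos_of_ne_zero fun h => by simp [h] at hk
    have hkn : k / Q ≤ n := Nat.lt_succ_iff.1 ((Nat.div_lt_iff_lt_mul hQ).2 hk)
    have hkq : k / Q * Q + k % Q = k := Nat.div_add_mod' k Q
    rw [Finset.sum_eq_single_of_mem (k % Q) (Finset.mem_range.2 (Nat.mod_lt k hQ))]
    · have := hz (k % Q) (Nat.mod_lt k hQ) (k / Q) hkn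
      simp only [hkq] at this
      rw [this, tent_one_sub (hw _)]
    · intro q hq hne
      have hq := Finset.mem_range.1 hq
      refine tent_eq_zero (hX q hq _ ht fun s _ heq => hne ?_)
      rw [hE.injective heq, Nat.mul_add_mod', Nat.mod_eq_of_lt hq]
  · rw [hwS t fun h => hmem ?_]
    · refine Finset.sum_eq_zero fun q hq => ?_
      have hq := Finset.mem_range.1 hq
      refine tent_eq_zero (hX q hq t ht fun s hs heq => hmem ⟨s * Q + q, ?_, heq.symm⟩)
      calc s * Q + q < s * Q + Q := by omega
        _ = (s + 1) * Q := by ring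
        _ ≤ (n + 1) * Q := Nat.mul_le_mul_right _ (by omega)
    · obtain ⟨k, hk, hkt⟩ := hES t h
      exact ⟨k, hk.trans_le hS, hkt⟩

/-! ### Features computed by the hidden layers -/

namespace FNNParams

variable {L : ℕ} {d : ℕ → ℕ} {N : ℕ}

/-- The output of a layer depends only on the parameters of the layers before it. -/
theorem layerOut_congr (σ : ℝ → ℝ) {θ θ' : FNNParams L d} (x : Fin (d 0) → ℝ) :
    ∀ (k : ℕ) (hk : k ≤ L), (∀ l : Fin L, (l : ℕ) < k → θ.W l = θ'.W l ∧ θ.b l = θ'.b l) →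
      layerOut σ θ x k hk = layerOut σ θ' x k hk
  | 0, _, _ => rfl
  | k + 1, hk, h => by
    have ih := layerOut_congr σ x k (Nat.le_of_succ_le hk) fun l hl => h l (hl.trans k.lt_succ_self)
    obtain ⟨hW, hb⟩ := h ⟨k, hk⟩ k.lt_succ_self
    simp only [layerOut, ih, hW, hb]

/-- The parameters of one layer can be chosen freely without affecting the layers before it. -/
theorem exists_extend (σ : ℝ → ℝ) (θ : FNNParams L d) (k : ℕ) (hk : k + 1 ≤ L)
    (W : Matrix (Fin (d (k + 1))) (Fin (d k)) ℝ) (b : Fin (d (k + 1)) → ℝ) :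
    ∃ θ' : FNNParams L d, ∀ x, layerOut σ θ' x (k + 1) hk =
      let z := W.mulVec (layerOut σ θ x k (Nat.le_of_succ_le hk)) + b
      if k + 1 < L then fun i => σ (z i) else z := by
  refine ⟨⟨Function.update θ.W ⟨k, hk⟩ W, Function.update θ.b ⟨k, hk⟩ b⟩, fun x => ?_⟩
  simp only [layerOut, Function.update_self]
  rw [layerOut_congr σ (θ' := θ) x k (Nat.le_of_succ_le hk)]
  intro l hl
  have hne : l ≠ ⟨k, hk⟩ := by rintro rfl; exact lt_irrefl _ hl
  exact ⟨Function.update_of_ne hne _ _, Function.update_of_ne hne _ _⟩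

/-- The functions on the dataset computed by the nodes of layer `k`. -/
def nodeFeatures (σ : ℝ → ℝ) (θ : FNNParams L d) (x : Fin N → Fin (d 0) → ℝ) (k : ℕ)
    (hk : k ≤ L) : Set (Fin N → ℝ) :=
  Set.range fun r i => layerOut σ θ (x i) k hk r

/-- The functions on the dataset that are affine combinations of functions in `F`. -/
def affineFeatures (F : Set (Fin N → ℝ)) : Submodule ℝ (Fin N → ℝ) :=
  Submodule.span ℝ (insert 1 F)

theorem subset_affineFeatures {F : Set (Fin N → ℝ)} : F ⊆ affineFeatures F :=
  (Set.subset_insert _ _).trans Submodule.subset_span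

theorem const_mem_affineFeatures (F : Set (Fin N → ℝ)) (c : ℝ) :
    (fun _ => c) ∈ affineFeatures F := by
  have h := (affineFeatures F).smul_mem c (Submodule.subset_span (Set.mem_insert 1 F))
  convert h using 1
  ext i; simp

theorem affineFeatures_le {F F' : Set (Fin N → ℝ)} (h : F' ⊆ affineFeatures F) :
    affineFeatures F' ≤ affineFeatures F :=
  Submodule.span_le.2 (Set.insert_subset (const_mem_affineFeatures F 1) h)

/-- An affine combination of node outputs is given by a row of weights and a bias. -/
theorem exists_weights_of_mem_affineFeatures {n : ℕ} {A : Fin N → Fin n → ℝ} {f : Fin N → ℝ}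
    (h : f ∈ affineFeatures (Set.range fun r i => A i r)) :
    ∃ (v : Fin n → ℝ) (β : ℝ), ∀ i, f i = v ⬝ᵥ A i + β := by
  obtain ⟨β, g, hg, rfl⟩ := Submodule.mem_span_insert.1 h
  obtain ⟨v, rfl⟩ := (Submodule.mem_span_range_iff_exists_fun ℝ).1 hg
  refine ⟨v, β, fun i => ?_⟩
  simp [dotProduct, Finset.sum_apply, add_comm]

/-- Any affine functions of the output of layer `k` can serve as the pre-activations of layer
`k + 1`. -/
theorem exists_preactivations (σ : ℝ → ℝ) (θ : FNNParams L d) (x : Fin N → Fin (d 0) → ℝ)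
    (k : ℕ) (hk : k + 1 ≤ L) (f : Fin (d (k + 1)) → Fin N → ℝ)
    (hf : ∀ r, f r ∈ affineFeatures (nodeFeatures σ θ x k (Nat.le_of_succ_le hk))) :
    ∃ θ' : FNNParams L d, ∀ i r, layerOut σ θ' (x i) (k + 1) hk r =
      if k + 1 < L then σ (f r i) else f r i := by
  choose v β hv using fun r => exists_weights_of_mem_affineFeatures (hf r)
  obtain ⟨θ', h⟩ := exists_extend σ θ k hk (Matrix.of v) β
  refine ⟨θ', fun i r => ?_⟩
  rw [h]
  simp only [hv]
  split_ifs <;> rfl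

/-- For some choice of the parameters, every function in `F` on the dataset `x` is an affine
function of the output of layer `k`. Passing to affine functions makes the notion insensitive to
the affine map that the next layer applies first. -/
def Computes (L : ℕ) {d : ℕ → ℕ} (σ : ℝ → ℝ) (x : Fin N → Fin (d 0) → ℝ) (k : ℕ)
    (F : Set (Fin N → ℝ)) : Prop :=
  ∃ (hk : k ≤ L) (θ : FNNParams L d), F ⊆ affineFeatures (nodeFeatures σ θ x k hk)

variable {σ : ℝ → ℝ} {x : Fin N → Fin (d 0) → ℝ} {k : ℕ} {F F' : Set (Fin N → ℝ)}

theorem Computes.mono (h : Computes L σ x k F) (hF : F' ⊆ affineFeatures F) :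
    Computes L σ x k F' := by
  obtain ⟨hk, θ, hθ⟩ := h
  exact ⟨hk, θ, hF.trans (affineFeatures_le hθ)⟩

theorem computes_zero (L : ℕ) (σ : ℝ → ℝ) (x : Fin N → Fin (d 0) → ℝ) :
    Computes L σ x 0 (Set.range fun r i => x i r) :=
  ⟨Nat.zero_le L, ⟨0, 0⟩, subset_affineFeatures⟩

/-- A hidden layer of width at least `G.card` applies the activation to every function in `G`. -/
theorem Computes.activate (h : Computes L σ x k F) (hk : k + 1 < L) (G : Finset (Fin N → ℝ))
    (hG : ↑G ⊆ (affineFeatures F : Set (Fin N → ℝ))) (hcard : G.card ≤ d (k + 1)) :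
    Computes L σ x (k + 1) ((fun (g : Fin N → ℝ) i => σ (g i)) '' (G : Set (Fin N → ℝ))) := by
  obtain ⟨hk', θ, hθ⟩ := h
  have hG := hG.trans (affineFeatures_le hθ)
  obtain ⟨θ', hθ'⟩ := exists_preactivations σ θ x k hk.le
    (fun r => if hr : (r : ℕ) < G.card then (G.equivFin.symm ⟨r, hr⟩ : Fin N → ℝ) else 0)
    (fun r => by
      split_ifs with hr
      · exact hG (G.equivFin.symm ⟨r, hr⟩).2
      · exact Submodule.zero_mem _)
  refine ⟨hk.le, θ', ?_⟩
  rintro _ ⟨g, hg, rfl⟩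
  refine subset_affineFeatures ⟨⟨G.equivFin ⟨g, hg⟩, (Fin.is_lt _).trans_le hcard⟩, ?_⟩
  ext i
  simp [hθ', hk]

/-- The output layer realizes any affine functions of the last hidden layer. -/
theorem Computes.exists_eval_eq (h : Computes L σ x k F) (hk : k + 1 = L)
    (y : Fin N → Fin (d L) → ℝ) (hy : ∀ r, (fun i => y i r) ∈ affineFeatures F) :
    ∃ θ : FNNParams L d, ∀ i, θ.eval σ (x i) = y i := by
  subst hk
  obtain ⟨hk', θ, hθ⟩ := h
  obtain ⟨θ', hθ'⟩ := exists_preactivations σ θ x k le_rfl (fun r i => y i r)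
    fun r => affineFeatures_le hθ (hy r)
  refine ⟨θ', fun i => ?_⟩
  ext r
  simp [eval, hθ']

end FNNParams

open FNNParams

/-! ### Layers with a ReLU-like activation -/

section

variable {L : ℕ} {d : ℕ → ℕ} {N : ℕ} {sPos sNeg : ℝ} {x : Fin N → Fin (d 0) → ℝ}
  {k : ℕ} {F : Set (Fin N → ℝ)}

/-- The activation is linear on nonnegative functions, so that these can be recovered from their
activations. -/
theorem mem_affineFeatures_of_activation_mem {f : Fin N → ℝ} (hpos : 0 < sPos) (hf : 0 ≤ f)
    (h : (fun i => reluLike sPos sNeg (f i)) ∈ affineFeatures F) : f ∈ affineFeatures F := by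
  convert (affineFeatures F).smul_mem sPos⁻¹ h using 1
  ext i
  simp [reluLike_of_nonneg sPos sNeg (hf i), hpos.ne']

/-- Nonnegative functions, one node for each, are carried through any number of layers. -/
theorem FNNParams.Computes.carry (h : Computes L (reluLike sPos sNeg) x k F) (hpos : 0 < sPos)
    (C : Finset (Fin N → ℝ)) (hC : ↑C ⊆ (affineFeatures F : Set (Fin N → ℝ)))
    (hnonneg : ∀ f ∈ C, 0 ≤ f) {k' : ℕ} (hkk' : k ≤ k') (hk' : k' < L)
    (hd : ∀ n, k + 1 ≤ n → n ≤ k' → C.card ≤ d n) :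
    Computes L (reluLike sPos sNeg) x k' C := by
  induction k', hkk' using Nat.le_induction with
  | base => exact h.mono hC
  | succ k' hkk' ih =>
    refine ((ih (by omega) fun n h1 h2 => hd n h1 (by omega)).activate hk' C
      subset_affineFeatures (hd _ (by omega) le_rfl)).mono fun f hf => ?_
    exact mem_affineFeatures_of_activation_mem (sNeg := sNeg) hpos (hnonneg f hf)
      (subset_affineFeatures ⟨f, hf, rfl⟩)

/-- `n + 1` nodes of a layer compute all piecewise linear functions of `c` with breakpoints
`τ 1, …, τ n`: the activation of the nonnegative function `c` yields the affine functions of `c`. -/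
theorem hingeSum_mem_affineFeatures (hpos : 0 < sPos) (hs : sNeg < sPos) {c : Fin N → ℝ}
    (hc : 0 ≤ c) {n : ℕ} {τ : ℕ → ℝ} (hcF : (fun i => reluLike sPos sNeg (c i)) ∈ affineFeatures F)
    (hτF : ∀ s ∈ Finset.Icc 1 n, (fun i => reluLike sPos sNeg (c i - τ s)) ∈ affineFeatures F)
    (a b : ℝ) (α : ℕ → ℝ) : (fun i => hingeSum n τ a b α (c i)) ∈ affineFeatures F := by
  have hcF := mem_affineFeatures_of_activation_mem hpos hc hcF
  have hhinge : ∀ s ∈ Finset.Icc 1 n, (fun i => max (c i - τ s) 0) ∈ affineFeatures F := by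
    intro s hsn
    have h := (affineFeatures F).smul_mem (sPos - sNeg)⁻¹ ((affineFeatures F).sub_mem (hτF s hsn)
      ((affineFeatures F).smul_mem sNeg ((affineFeatures F).sub_mem hcF
        (const_mem_affineFeatures F (τ s)))))
    convert h using 1
    ext i
    have : sPos - sNeg ≠ 0 := (sub_pos.2 hs).ne'
    simp only [Pi.smul_apply, Pi.sub_apply, smul_eq_mul, reluLike_eq]
    field_simp
    ring
  have h := (affineFeatures F).add_mem ((affineFeatures F).add_mem
    ((affineFeatures F).smul_mem a hcF) (const_mem_affineFeatures F b))
    ((affineFeatures F).sum_mem fun s hs => (affineFeatures F).smul_mem (α s) (hhinge s hs))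
  convert h using 1
  ext i
  simp [hingeSum]

/-- Two consecutive hidden layers fit arbitrary values in `[0, 1]` on a set `S` of data points
and `0` at all others, while carrying the nonnegative functions in `C`. -/
theorem FNNParams.Computes.fit (h : Computes L (reluLike sPos sNeg) x k F) (hpos : 0 < sPos)
    (hs : sNeg < sPos) (hk : k + 2 < L) {c : Fin N → ℝ} (hcF : c ∈ affineFeatures F) (hc : 0 ≤ c)
    (hinj : Function.Injective c) (C : Finset (Fin N → ℝ))
    (hC : ↑C ⊆ (affineFeatures F : Set (Fin N → ℝ))) (hnonneg : ∀ f ∈ C, 0 ≤ f)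
    {p Q D : ℕ} (hp : p + C.card ≤ d (k + 1)) (hQ : 3 * (Q * D) + C.card ≤ d (k + 2))
    (S : Finset (Fin N)) (hS : S.card ≤ p * Q) (w : Fin D → Fin N → ℝ)
    (hw : ∀ κ i, w κ i ∈ Set.Icc (0 : ℝ) 1) (hwS : ∀ κ, ∀ i ∉ S, w κ i = 0) :
    Computes L (reluLike sPos sNeg) x (k + 2) (C ∪ Set.range w) := by
  classical
  rcases Nat.eq_zero_or_pos p with rfl | hp0
  · -- nothing is to be fitted
    have hw0 : ∀ κ, w κ = 0 := fun κ => funext fun i => hwS κ i (by simp_all)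
    refine (h.carry hpos C hC hnonneg (k' := k + 2) (by omega) hk fun n h1 h2 => ?_).mono ?_
    · obtain rfl | rfl : n = k + 1 ∨ n = k + 2 := by omega
      · omega
      · omega
    · rintro f (hf | ⟨κ, rfl⟩)
      · exact subset_affineFeatures hf
      · rw [hw0]; exact Submodule.zero_mem _
  obtain ⟨n, rfl⟩ : ∃ n, p = n + 1 := ⟨p - 1, by omega⟩
  obtain ⟨τ, hτ⟩ := exists_sum_tent_hingeSum (Finset.univ.image c) (S.image c) n Q
    (Finset.card_image_le.trans hS)
  have hfit : ∀ κ, ∃ (a b : ℕ → ℝ) (α : ℕ → ℕ → ℝ), ∀ i,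
      ∑ q ∈ Finset.range Q, tent (hingeSum n τ (a q) (b q) (α q) (c i)) = w κ i := by
    intro κ
    obtain ⟨a, b, α, hab⟩ := hτ (Function.extend c (w κ) 0) (fun t => by
        by_cases ht : ∃ i, c i = t
        · obtain ⟨i, rfl⟩ := ht
          rw [hinj.extend_apply]; exact hw κ i
        · rw [Function.extend_apply' _ _ _ ht]; simp)
      (fun t ht => by
        by_cases ht' : ∃ i, c i = t
        · obtain ⟨i, rfl⟩ := ht'
          rw [hinj.extend_apply]
          exact hwS κ i fun hi => ht (Finset.mem_image_of_mem c hi)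
        · rw [Function.extend_apply' _ _ _ ht']; simp)
    refine ⟨a, b, α, fun i => ?_⟩
    rw [hab (c i) (Finset.mem_image_of_mem c (Finset.mem_univ i)), hinj.extend_apply]
  choose a b α hab using hfit
  -- the first of the two layers
  let G₁ : Finset (Fin N → ℝ) := insert c ((Finset.Icc 1 n).image fun s i => c i - τ s) ∪ C
  have hG₁ : G₁.card ≤ d (k + 1) := by
    have h1 := Finset.card_union_le (insert c ((Finset.Icc 1 n).image fun s i => c i - τ s)) C
    have h2 := Finset.card_insert_le c ((Finset.Icc 1 n).image fun s i => c i - τ s)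
    have h3 := Finset.card_image_le (s := Finset.Icc 1 n) (f := fun s (i : Fin N) => c i - τ s)
    rw [Nat.card_Icc] at h3
    change (_ ∪ _ : Finset _).card ≤ _
    omega
  have h₁ := h.activate (by omega) G₁ (by
    intro f hf
    simp only [G₁, Finset.coe_union, Finset.coe_insert, Finset.coe_image] at hf
    rcases hf with (rfl | ⟨s, -, rfl⟩) | hf
    · exact hcF
    · exact (affineFeatures F).sub_mem hcF (const_mem_affineFeatures F (τ s))
    · exact hC hf) hG₁
  set F₁ := (fun (g : Fin N → ℝ) i => reluLike sPos sNeg (g i)) '' (G₁ : Set (Fin N → ℝ))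
  have hF₁ : ∀ f ∈ G₁, (fun i => reluLike sPos sNeg (f i)) ∈ affineFeatures F₁ := fun f hf =>
    subset_affineFeatures (Set.mem_image_of_mem _ (Finset.mem_coe.2 hf))
  have hC₁ : ∀ f ∈ C, f ∈ affineFeatures F₁ := fun f hf =>
    mem_affineFeatures_of_activation_mem hpos (hnonneg f hf)
      (hF₁ f (Finset.mem_union_right _ hf))
  have hg₁ : ∀ κ q, (fun i => hingeSum n τ (a κ q) (b κ q) (α κ q) (c i)) ∈ affineFeatures F₁ :=
    fun κ q => hingeSum_mem_affineFeatures hpos hs hc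
      (hF₁ c (Finset.mem_union_left _ (Finset.mem_insert_self _ _)))
      (fun s hs => hF₁ (fun i => c i - τ s) <|
        Finset.mem_union_left _ <| Finset.mem_insert_of_mem <|
          Finset.mem_image_of_mem (fun s i => c i - τ s) hs)
      _ _ _
  -- the second layer: the three translates of each zigzag function that make up a tent
  let g : ℝ → ℕ × Fin D → Fin N → ℝ := fun e qκ i =>
    hingeSum n τ (a qκ.2 qκ.1) (b qκ.2 qκ.1) (α qκ.2 qκ.1) (c i) + e
  let I : Finset (ℕ × Fin D) := Finset.range Q ×ˢ Finset.univ
  let G₂ : Finset (Fin N → ℝ) := I.image (g 1) ∪ I.image (g 0) ∪ I.image (g (-1)) ∪ C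
  have hG₂ : G₂.card ≤ d (k + 1 + 1) := by
    have hI : I.card = Q * D := by simp [I]
    have h1 := Finset.card_union_le (I.image (g 1) ∪ I.image (g 0) ∪ I.image (g (-1))) C
    have h2 := Finset.card_union_le (I.image (g 1) ∪ I.image (g 0)) (I.image (g (-1)))
    have h3 := Finset.card_union_le (I.image (g 1)) (I.image (g 0))
    have h4 : ∀ e, (I.image (g e)).card ≤ I.card := fun e => Finset.card_image_le
    have h5 := h4 1
    have h6 := h4 0
    have h7 := h4 (-1)
    change (_ ∪ _ : Finset _).card ≤ d (k + 2)
    omega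
  have hg₂ : ∀ e qκ, g e qκ ∈ affineFeatures F₁ := fun e qκ =>
    (affineFeatures F₁).add_mem (hg₁ qκ.2 qκ.1) (const_mem_affineFeatures F₁ e)
  have h₂ := h₁.activate hk G₂ (by
    intro f hf
    simp only [G₂, Finset.coe_union, Finset.coe_image] at hf
    rcases hf with ((⟨_, -, rfl⟩ | ⟨_, -, rfl⟩) | ⟨_, -, rfl⟩) | hf
    · exact hg₂ _ _
    · exact hg₂ _ _
    · exact hg₂ _ _
    · exact hC₁ f hf) hG₂
  refine h₂.mono ?_
  set F₂ := (fun (g : Fin N → ℝ) i => reluLike sPos sNeg (g i)) '' (G₂ : Set (Fin N → ℝ))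
  have hF₂ : ∀ f ∈ G₂, (fun i => reluLike sPos sNeg (f i)) ∈ affineFeatures F₂ := fun f hf =>
    subset_affineFeatures (Set.mem_image_of_mem _ (Finset.mem_coe.2 hf))
  rintro f (hf | ⟨κ, rfl⟩)
  · exact mem_affineFeatures_of_activation_mem hpos (hnonneg f hf)
      (hF₂ f (Finset.mem_union_right _ hf))
  have hmem : ∀ q ∈ Finset.range Q, ∀ e : ℝ, (e = 1 ∨ e = 0 ∨ e = -1) →
      (fun i => reluLike sPos sNeg (g e (q, κ) i)) ∈ affineFeatures F₂ := by
    intro q hq e he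
    have hI : (q, κ) ∈ I := by simpa [I] using hq
    refine hF₂ (g e (q, κ)) ?_
    simp only [G₂, Finset.mem_union]
    rcases he with rfl | rfl | rfl
    · exact Or.inl (Or.inl (Or.inl (Finset.mem_image_of_mem _ hI)))
    · exact Or.inl (Or.inl (Or.inr (Finset.mem_image_of_mem _ hI)))
    · exact Or.inl (Or.inr (Finset.mem_image_of_mem _ hI))
  have htent := (affineFeatures F₂).smul_mem (sPos - sNeg)⁻¹ <|
    (affineFeatures F₂).sum_mem fun q (hq : q ∈ Finset.range Q) =>
      (affineFeatures F₂).add_mem ((affineFeatures F₂).sub_mem (hmem q hq 1 (by simp))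
        ((affineFeatures F₂).smul_mem (2 : ℝ) (hmem q hq 0 (by simp)))) (hmem q hq (-1) (by simp))
  rw [SetLike.mem_coe]
  convert htent using 1
  ext i
  have hne : sPos - sNeg ≠ 0 := (sub_pos.2 hs).ne'
  simp only [Pi.smul_apply, Pi.sub_apply, Pi.add_apply, Finset.sum_apply, smul_eq_mul, g, add_zero,
    ← sub_eq_add_neg, reluLike_second_difference, ← Finset.mul_sum, hab]
  field_simp

end

/-! ### Memorization by several blocks of two layers -/

/-- A generic linear functional separates finitely many points. -/
theorem exists_separating_functional {N n : ℕ} {x : Fin N → Fin n → ℝ}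
    (hx : Function.Injective x) :
    ∃ φ : Module.Dual ℝ (Fin n → ℝ), Function.Injective fun i => φ (x i) := by
  obtain ⟨φ, hφ⟩ := Module.exists_dual_forall_apply_ne_zero (K := ℝ)
    (fun p : {p : Fin N × Fin N // p.1 ≠ p.2} => x p.1.1 - x p.1.2)
    fun p => sub_ne_zero.2 (hx.ne p.2)
  refine ⟨φ, fun i j hij => by_contra fun hne => hφ ⟨(i, j), hne⟩ ?_⟩
  simpa [sub_eq_zero] using hij

/-- Items can be distributed over bins of sufficient total capacity. -/
theorem exists_assignment {N : ℕ} (J : Finset ℕ) (cap : ℕ → ℕ) (h : N ≤ ∑ j ∈ J, cap j) :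
    ∃ blk : Fin N → ℕ, (∀ i, blk i ∈ J) ∧
      ∀ j, (Finset.univ.filter fun i => blk i = j).card ≤ cap j := by
  classical
  -- number the places in the bins
  obtain ⟨e⟩ : Nonempty (Fin N ↪ (J.sigma fun j => (Finset.univ : Finset (Fin (cap j))))) :=
    Function.Embedding.nonempty_of_card_le (by simpa using h)
  have hmem := fun i => Finset.mem_sigma.1 (e i).2
  refine ⟨fun i => (e i).1.1, fun i => (hmem i).1, fun j => ?_⟩
  have hcard := Finset.card_le_card_of_injOn (s := Finset.univ.filter fun i => (e i).1.1 = j)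
    (t := (Finset.univ : Finset (Fin (cap j))).map
      (Function.Embedding.sigmaMk (β := fun j => Fin (cap j)) j))
    (fun i => (e i).1) (fun i hi => by
      have hi : (e i).1.1 = j := by simpa using hi
      subst hi
      simp [Function.Embedding.sigmaMk])
    (fun i _ i' _ hii' => e.injective (Subtype.ext hii'))
  simpa using hcard

theorem floor_natCast_sub_div (a r n : ℕ) (h : r ≤ a) :
    ⌊((a : ℝ) - r) / n⌋ = ((a - r) / n : ℕ) := by
  rw [← Nat.cast_sub h, Int.floor_div_natCast]
  simp

theorem corollary6
    -- the ReLU-like activation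
    (sPos sNeg : ℝ) (hsNeg : 0 ≤ sNeg) (hs : sNeg < sPos)
    -- depth and widths of the network; `d 0 = d_x` and `d L = d_y`
    (L : ℕ) (d : ℕ → ℕ) (hd : ∀ k, k ≤ L → 0 < d k)
    -- the dataset
    (N : ℕ) (x : Fin N → Fin (d 0) → ℝ) (y : Fin N → Fin (d L) → ℝ)
    (hx : Function.Injective x)
    (hy : ∀ i k, y i k ∈ Set.Icc (-1 : ℝ) 1)
    -- the indices `l 1, …, l m` in `{1, …, L - 2}`
    (m : ℕ) (hm : 1 ≤ m) (l : ℕ → ℕ)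
    (hl : ∀ j, 1 ≤ j → j ≤ m → 1 ≤ l j ∧ l j + 2 ≤ L)
    (hsep : ∀ j, 1 ≤ j → j < m → l j + 1 < l (j + 1))
    -- the `r_j` reserved nodes exist in layers `l j` and `l j + 1`
    (hr : ∀ j, 1 ≤ j → j ≤ m →
      reservedWidth (d L) m j ≤ d (l j) ∧ reservedWidth (d L) m j ≤ d (l j + 1))
    (hN : (N : ℤ) ≤ 4 * ∑ j ∈ Finset.Icc 1 m,
      ⌊((d (l j) : ℝ) - (reservedWidth (d L) m j : ℝ)) / 4⌋ *
      ⌊((d (l j + 1) : ℝ) - (reservedWidth (d L) m j : ℝ)) / (4 * (d L : ℝ))⌋)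
    (hmid : ∀ j, 1 ≤ j → j < m → ∀ k, l j + 2 ≤ k → k + 1 ≤ l (j + 1) → d L + 1 ≤ d k)
    (hlast : ∀ k, l m + 2 ≤ k → k + 1 ≤ L → d L ≤ d k) :
    ∃ θ : FNNParams L d, ∀ i : Fin N, θ.eval (reluLike sPos sNeg) (x i) = y i := by
  classical
  have hpos : 0 < sPos := hsNeg.trans_lt hs
  -- block `j` fits `p j * Q j` points by means of `p j` breakpoints and `Q j` tents per output
  let p : ℕ → ℕ := fun j => 4 * ((d (l j) - reservedWidth (d L) m j) / 4)
  let Q : ℕ → ℕ := fun j => (d (l j + 1) - reservedWidth (d L) m j) / (4 * d L)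
  have hcap : N ≤ ∑ j ∈ Finset.Icc 1 m, p j * Q j := by
    zify
    refine hN.trans_eq ?_
    rw [Finset.mul_sum]
    refine Finset.sum_congr rfl fun j hj => ?_
    obtain ⟨h1, h2⟩ := Finset.mem_Icc.1 hj
    have e1 := floor_natCast_sub_div _ _ 4 (hr j h1 h2).1
    have e2 := floor_natCast_sub_div _ _ (4 * d L) (hr j h1 h2).2
    push_cast at e1 e2
    rw [e1, e2]
    simp only [p, Q]
    push_cast
    ring
  obtain ⟨blk, hblk, hblkcard⟩ := exists_assignment _ _ hcap
  -- a nonnegative injective affine coordinate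
  obtain ⟨φ, hφ⟩ := exists_separating_functional hx
  obtain ⟨B, hB⟩ := (Finset.univ.image fun i => -φ (x i)).exists_le
  let c : Fin N → ℝ := fun i => φ (x i) + B
  have hc : 0 ≤ c := fun i => by
    have := hB _ (Finset.mem_image_of_mem _ (Finset.mem_univ i))
    simp only [c, Pi.zero_apply]; linarith
  have hcinj : Function.Injective c := fun i i' h => hφ (add_right_cancel h)
  have hcF : c ∈ affineFeatures (Set.range fun r i => x i r) := by
    refine (affineFeatures _).add_mem (Submodule.span_mono (Set.subset_insert _ _) ?_)
      (const_mem_affineFeatures _ B)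
    refine (Submodule.mem_span_range_iff_exists_fun ℝ).2 ⟨fun r => φ (Pi.single r 1), ?_⟩
    ext i
    simp only [Finset.sum_apply, Pi.smul_apply, smul_eq_mul]
    conv_rhs => rw [← LinearMap.sum_single_apply (fun _ => ℝ) (x i), map_sum]
    refine Finset.sum_congr rfl fun r _ => ?_
    rw [show (Pi.single r (x i r) : Fin (d 0) → ℝ) = x i r • Pi.single r 1 by
      rw [← Pi.single_smul]; simp, map_smul, smul_eq_mul, mul_comm]
  -- the labels moved to `[0, 1]`, and their part accumulated after block `j`
  let w : ℕ → Fin (d L) → Fin N → ℝ := fun j κ i => if blk i = j then (y i κ + 1) / 2 else 0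
  let acc : ℕ → Fin (d L) → Fin N → ℝ := fun j κ i => if blk i ≤ j then (y i κ + 1) / 2 else 0
  have hy' : ∀ i κ, (y i κ + 1) / 2 ∈ Set.Icc (0 : ℝ) 1 := fun i κ =>
    ⟨by linarith [(hy i κ).1], by linarith [(hy i κ).2]⟩
  have hw : ∀ j κ i, w j κ i ∈ Set.Icc (0 : ℝ) 1 := fun j κ i => by
    simp only [w]; split_ifs
    · exact hy' i κ
    · simp
  have hacc : ∀ j κ, 0 ≤ acc j κ := fun j κ i => by
    simp only [acc]; split_ifs
    · exact (hy' i κ).1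
    · exact le_rfl
  have hacc0 : ∀ κ, acc 0 κ = 0 := fun κ => funext fun i => by
    have := (Finset.mem_Icc.1 (hblk i)).1
    simp only [acc, show ¬ blk i ≤ 0 by omega, if_false, Pi.zero_apply]
  have hacc_succ : ∀ j κ, acc (j + 1) κ = acc j κ + w (j + 1) κ := fun j κ => funext fun i => by
    simp only [acc, w, Pi.add_apply]
    rcases lt_trichotomy (blk i) (j + 1) with h | h | h
    · simp [h.le, h.ne, Nat.lt_succ_iff.1 h]
    · simp [h]
    · simp [h.ne', show ¬ blk i ≤ j + 1 by omega, show ¬ blk i ≤ j by omega]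
  let A : ℕ → Finset (Fin N → ℝ) := fun j => Finset.univ.image (acc j)
  have hA : ∀ j, (A j).card ≤ d L := fun j => Finset.card_image_le.trans_eq (by simp)
  have hAnonneg : ∀ j, ∀ f ∈ A j, 0 ≤ f := fun j f hf => by
    obtain ⟨κ, -, rfl⟩ := Finset.mem_image.1 hf
    exact hacc j κ
  -- block `j + 1`, with the functions in `C` being those that later layers need
  have block : ∀ j < m, ∀ C : Finset (Fin N → ℝ), C.card ≤ reservedWidth (d L) m (j + 1) →
      (∀ f ∈ C, 0 ≤ f) → C ⊆ insert c (A j) → (0 < j → A j ⊆ C) →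
      Computes L (reluLike sPos sNeg) x (l (j + 1) - 1) (insert c (A j : Set (Fin N → ℝ))) →
      Computes L (reluLike sPos sNeg) x (l (j + 1) + 1) (C ∪ A (j + 1)) := by
    intro j hj C hCcard hCnonneg hCsub hAC h
    obtain ⟨hl1, hl2⟩ := hl (j + 1) (by omega) (by omega)
    obtain ⟨hr1, hr2⟩ := hr (j + 1) (by omega) (by omega)
    have hp := Nat.mul_div_le (d (l (j + 1)) - reservedWidth (d L) m (j + 1)) 4
    have hQ := Nat.mul_div_le (d (l (j + 1) + 1) - reservedWidth (d L) m (j + 1)) (4 * d L)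
    -- a tent costs three nodes, so a quarter of the available width is more than enough
    have hQ' : 4 * (Q (j + 1) * d L) ≤ d (l (j + 1) + 1) - reservedWidth (d L) m (j + 1) := by
      calc 4 * (Q (j + 1) * d L) = 4 * d L * Q (j + 1) := by ring
        _ ≤ _ := hQ
    obtain ⟨k, hk⟩ : ∃ k, l (j + 1) = k + 1 := ⟨l (j + 1) - 1, by omega⟩
    have hfit := h.fit hpos hs (by omega) (subset_affineFeatures (Set.mem_insert _ _)) hc hcinj C
      (fun f hf => subset_affineFeatures (by simpa using hCsub hf)) hCnonneg
      (p := p (j + 1)) (Q := Q (j + 1)) (D := d L)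
      (by rw [Nat.sub_add_cancel hl1]; simp only [p]; omega)
      (by rw [show l (j + 1) - 1 + 2 = l (j + 1) + 1 by omega]; omega)
      (Finset.univ.filter fun i => blk i = j + 1) (hblkcard (j + 1)) (w (j + 1))
      (hw (j + 1)) (fun κ i hi => if_neg (by simpa using hi))
    rw [show l (j + 1) - 1 + 2 = l (j + 1) + 1 by omega] at hfit
    refine hfit.mono (Set.union_subset
      (fun f hf => subset_affineFeatures (Or.inl hf)) fun f hf => ?_)
    obtain ⟨κ, -, rfl⟩ := Finset.mem_image.1 (Finset.mem_coe.1 hf)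
    rw [hacc_succ]
    refine Submodule.add_mem _ ?_ (subset_affineFeatures (Or.inr ⟨κ, rfl⟩))
    rcases Nat.eq_zero_or_pos j with rfl | h0
    · rw [hacc0]; exact Submodule.zero_mem _
    · exact subset_affineFeatures (Or.inl (hAC h0 (Finset.mem_image_of_mem _ (Finset.mem_univ κ))))
  -- just below block `j + 1`, the coordinate and the accumulated labels are available
  have state : ∀ j < m, Computes L (reluLike sPos sNeg) x (l (j + 1) - 1)
      (insert c (A j : Set (Fin N → ℝ))) := by
    intro j
    induction j with
    | zero =>
      intro _
      obtain ⟨hl1, hl2⟩ := hl 1 le_rfl hm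
      refine ((computes_zero L _ x).carry hpos {c} (by simpa using hcF) (by simpa using hc)
        (k' := l 1 - 1) (by omega) (by omega) fun n _ _ => ?_).mono ?_
      · rw [Finset.card_singleton]; exact hd n (by omega)
      · refine Set.insert_subset (subset_affineFeatures (by simp)) fun f hf => ?_
        obtain ⟨κ, -, rfl⟩ := Finset.mem_image.1 (Finset.mem_coe.1 hf)
        rw [hacc0]; exact Submodule.zero_mem _
    | succ j ih =>
      intro hj
      have hcard : ∀ j, (insert c (A j)).card ≤ d L + 1 := fun j =>
        (Finset.card_insert_le _ _).trans (Nat.add_le_add_right (hA j) 1)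
      have hblock : Computes L (reluLike sPos sNeg) x (l (j + 1) + 1)
          (insert c (A (j + 1) : Set (Fin N → ℝ))) := by
        rcases Nat.eq_zero_or_pos j with rfl | h0
        · refine (block 0 (by omega) {c} ?_ (by simpa using hc) (by simp) (by simp)
            (ih (by omega))).mono fun f hf => subset_affineFeatures ?_
          · simp [reservedWidth, hj]
          · simpa using hf
        · refine (block j (by omega) (insert c (A j)) ?_ ?_ subset_rfl
            (fun _ => Finset.subset_insert _ _) (ih (by omega))).mono
            fun f hf => subset_affineFeatures ?_
          · simpa [reservedWidth, hj, h0] using hcard j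
          · intro f hf
            rcases Finset.mem_insert.1 hf with rfl | hf
            · exact hc
            · exact hAnonneg j f hf
          · rcases hf with rfl | hf
            · exact Or.inl (by simp)
            · exact Or.inr hf
      have hsep' := hsep (j + 1) (by omega) hj
      obtain ⟨hl1, hl2⟩ := hl (j + 1 + 1) (by omega) (by omega)
      refine (hblock.carry hpos (insert c (A (j + 1))) ?_ ?_ (k' := l (j + 1 + 1) - 1) (by omega)
        (by omega) fun n h1 h2 => ?_).mono ?_
      · rw [Finset.coe_insert]; exact subset_affineFeatures
      · intro f hf
        rcases Finset.mem_insert.1 hf with rfl | hf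
        · exact hc
        · exact hAnonneg _ f hf
      · exact (hcard _).trans (hmid (j + 1) (by omega) hj n (by omega) (by omega))
      · rw [Finset.coe_insert]; exact subset_affineFeatures
  -- the last block no longer carries the coordinate `c`
  obtain ⟨j, rfl⟩ : ∃ j, m = j + 1 := ⟨m - 1, by omega⟩
  have hend : Computes L (reluLike sPos sNeg) x (l (j + 1) + 1)
      (A (j + 1) : Set (Fin N → ℝ)) := by
    rcases Nat.eq_zero_or_pos j with rfl | h0
    · exact (block 0 (by omega) ∅ (by simp) (by simp) (by simp) (by simp)
        (state 0 (by omega))).mono fun f hf => subset_affineFeatures (Or.inr hf)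
    · refine (block j (by omega) (A j) ?_ (hAnonneg j) (Finset.subset_insert _ _)
        (fun _ => subset_rfl) (state j (by omega))).mono
        fun f hf => subset_affineFeatures (Or.inr hf)
      simpa [reservedWidth, h0] using hA j
  obtain ⟨hl1, hl2⟩ := hl (j + 1) (by omega) le_rfl
  refine (hend.carry hpos (A (j + 1)) subset_affineFeatures (hAnonneg _) (k' := L - 1) (by omega)
    (by omega) fun n h1 h2 =>
      (hA _).trans (hlast n (by omega) (by omega))).exists_eval_eq (by omega) y fun κ => ?_
  have hmem : acc (j + 1) κ ∈ affineFeatures (A (j + 1) : Set (Fin N → ℝ)) :=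
    subset_affineFeatures (Finset.mem_coe.2 (Finset.mem_image_of_mem _ (Finset.mem_univ κ)))
  convert (affineFeatures _).sub_mem ((affineFeatures _).smul_mem 2 hmem)
    (const_mem_affineFeatures _ 1) using 1
  ext i
  have := (Finset.mem_Icc.1 (hblk i)).2
  simp only [acc, this, if_true, Pi.sub_apply, Pi.smul_apply, smul_eq_mul]
  ring
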